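/- Let $n \ge 1$ and $0 \le t \le n-1$ be integers. An inversion sequence of length $n$ is an integer sequence $e=(e_1,\dots,e_n)$ with $0\le e_j\le j-1$ for all $1 \le j \le n$. It avoids $102$ if there are no indices $i_1<i_2<i_3$ such that replacing, for each $i$, the $i$-th smallest value occurring in $(e_{i_1},e_{i_2},e_{i_3})$ by $i-1$ gives $(1,0,2)$ (equivalently, such that $e_{i_2}<e_{i_1}<e_{i_3}$). With the convention $e_{n+1}=-1$, let $p(e)$ be the position of the first descent of $e$, i.e. the least $p\ge 1$ with $e_p>e_{p+1}$, and define the rank of $e$ to be $p(e)-\max(e)-1$. Let $\mathcal{IS}_{n,t}(102)$ be the set of $102$-avoiding inversion sequences of length $n$ with rank $t$. A UVD path of semilength $n$ is a lattice path from $(0,0)$ to $(2n,0)$ that stays weakly above the $x$-axis, consists of steps $u=(1,1)$, $d=(1,-1)$ and $v=(0,-2)$, has no two consecutive steps $uv$ or $vu$, and ends with a $d$ step. Let $\mathcal{UVD}_{n,t}$ be the set of UVD paths of semilength $n$ having exactly $t$ valleys on the $x$-axis, i.e. exactly $t$ occurrences of consecutive steps $du$ whose common point lies on the $x$-axis. Then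 both sets are finite and $$|\mathcal{IS}_{n,t}(102)| = |\mathcal{UVD}_{n,t}| = \sum_{j=t+1}^{n} (-1)^{n-j}\,\frac{t+1}{j}\binom{3j-t-2}{j-t-1}\binom{j}{n-j}.$$ -/

import Mathlib

/-! ### Inversion sequences -/

/-- `e = (e₁, …, eₙ)`, stored as `e : Fin n → ℕ` with `e i = e_{i+1}`, is an inversion sequence:
`0 ≤ e_j ≤ j - 1` for `1 ≤ j ≤ n`. -/
def IsInversionSeq {n : ℕ} (e : Fin n → ℕ) : Prop :=
  ∀ i : Fin n, e i ≤ (i : ℕ)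

/-- The reduction of a word: every entry equal to the `i`-th smallest value occurring in the word
is replaced by `i - 1`, that is, by the number of distinct smaller values in the word. -/
def wordReduction {k : ℕ} (w : Fin k → ℕ) : Fin k → ℕ :=
  fun a => ((Finset.univ.image w).filter (fun x => x < w a)).card

/-- `e` contains the pattern `w`: some subsequence of `e` has reduction `w`. -/
def ContainsPattern {n k : ℕ} (e : Fin n → ℕ) (w : Fin k → ℕ) : Prop :=
  ∃ i : Fin k → Fin n, StrictMono i ∧ wordReduction (e ∘ i) = w

/-- `e` avoids the pattern `w`. -/
def AvoidsPattern {n k : ℕ} (e : Fin n → ℕ) (w : Fin k → ℕ) : Prop :=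
  ¬ ContainsPattern e w

/-- The entry `e_j` for `1 ≤ j ≤ n` (one-based), and `-1` for every other `j`;
in particular `e_{n+1} = -1`. -/
def seqEntry {n : ℕ} (e : Fin n → ℕ) (j : ℕ) : ℤ :=
  if h : 1 ≤ j ∧ j ≤ n then (e ⟨j - 1, by omega⟩ : ℤ) else -1

/-- The (one-based) position of the first descent: the least `p ≥ 1` with `e_p > e_{p+1}`,
where `e_{n+1} = -1`. For `n ≥ 1` such a `p` exists, as `p = n` is one. -/
noncomputable def firstDescent {n : ℕ} (e : Fin n → ℕ) : ℕ :=
  sInf {p : ℕ | 1 ≤ p ∧ seqEntry e p > seqEntry e (p + 1)}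

/-- The largest entry of `e` (for `n ≥ 1`). -/
def seqMax {n : ℕ} (e : Fin n → ℕ) : ℕ :=
  Finset.univ.sup e

/-- The rank: position of the first descent, minus the largest entry, minus one
(an integer, so that no subtraction is truncated). -/
noncomputable def seqRank {n : ℕ} (e : Fin n → ℕ) : ℤ :=
  (firstDescent e : ℤ) - (seqMax e : ℤ) - 1

/-- The set of inversion sequences of length `n` that avoid `102`. -/
def IS102 (n : ℕ) : Set (Fin n → ℕ) :=
  {e | IsInversionSeq e ∧ AvoidsPattern e ![1, 0, 2]}

/-- The set of inversion sequences of length `n` that avoid `102` and have rank `t`. -/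
def IS102Rank (n t : ℕ) : Set (Fin n → ℕ) :=
  {e | e ∈ IS102 n ∧ seqRank e = (t : ℤ)}

/-! ### UVD paths -/

/-- Up steps, vertical steps and down steps. -/
inductive UVDStep where
  | u
  | v
  | d
deriving DecidableEq

/-- The displacements `u = (1, 1)`, `v = (0, -2)`, `d = (1, -1)`. -/
def UVDStep.vec : UVDStep → ℤ × ℤ
  | .u => (1, 1)
  | .v => (0, -2)
  | .d => (1, -1)

/-- The point reached from the origin by the steps of the word `S`. -/
def pathEnd (S : List UVDStep) : ℤ × ℤ :=
  (S.map UVDStep.vec).sum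

/-- The word `S` is a UVD path of semilength `n`: it leads from `(0, 0)` to `(2n, 0)`, stays weakly
above the horizontal axis, has no consecutive `uv` or `vu`, and ends with `d`. -/
structure IsUVDPath (n : ℕ) (S : List UVDStep) : Prop where
  pathEnd_eq : pathEnd S = (2 * (n : ℤ), 0)
  nonneg : ∀ P : List UVDStep, P <+: S → 0 ≤ (pathEnd P).2
  not_uv : ¬ [UVDStep.u, UVDStep.v] <:+: S
  not_vu : ¬ [UVDStep.v, UVDStep.u] <:+: S
  ends_d : [UVDStep.d] <:+ S

/-- The number of valleys `du` of `S` on the horizontal axis: positions `i` (zero-based) such that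
step `i` is `d`, step `i + 1` is `u`, and the point between them has height `0`. -/
def axisValleys (S : List UVDStep) : ℕ :=
  ((Finset.range S.length).filter (fun i =>
    S[i]? = some UVDStep.d ∧ S[i + 1]? = some UVDStep.u ∧ (pathEnd (S.take (i + 1))).2 = 0)).card

/-- The set of UVD paths of semilength `n`. -/
def UVDPaths (n : ℕ) : Set (List UVDStep) :=
  {S | IsUVDPath n S}

/-- The set of UVD paths of semilength `n` with exactly `t` valleys on the horizontal axis. -/
def UVDPathsValleys (n t : ℕ) : Set (List UVDStep) :=
  {S | S ∈ UVDPaths n ∧ axisValleys S = t}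

/-! ### The common recurrence -/

/-! All three quantities equal the coefficient of `X ^ n` in `P ^ (t + 1)`, where `P` is the power
series without constant term satisfying `P * (1 - P) ^ 2 = X - X ^ 2`. Multiplying this equation by
`P ^ s` gives a recurrence for the coefficients of the powers: the second difference in `s` of row
`n + 2` is row `n + 1` minus row `n`. Together with the boundary values it determines the array
(`IsRankArray.unique`), so neither a bijection between sequences and paths nor Lagrange inversion is
needed.

Closed form: `P` is `R` evaluated at `w = X - X ^ 2`, where `R * (1 - R) ^ 2 = w`. The ballot
numbers are the coefficients of `R ^ s`, the alternating binomials those of `(X - X ^ 2) ^ j`. That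
the resulting sum obeys the recurrence is checked directly (`ballotCoeff_second_difference`, then
Pascal's rule).

Sequences: let `M` be the largest entry, and suppose that it occurs at the zero-based position `M +
t` with no descent before. If `M` also occurs elsewhere, this copy can be deleted; if not, it can be
lowered to `M - 1`; if the next entry is `M` too, one of the two copies can be deleted. These
bijections give linear relations between the sizes of `MaxAt`, `RankGe` and `RankEq`, and
eliminating the first two leaves the recurrence.

Paths: initial segments are sorted by the number of `d` and `v` steps, final height, axis valleys
and last letter. Put `P = X * Q` and `T = 1 / (1 - P)`. Removing the last letter gives a system of
recurrences solved by products of powers of `P` and `T` (`hasCount_UVDWords`). A path that ends on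
the axis with `d` after `t` axis valleys is counted by `P ^ (t + 1)`. -/

/-- The recurrence, with boundary values, satisfied by the coefficients of `Xⁿ` in the powers `P ^ s`
of the power series `P` with `P * (1 - P) ^ 2 = X - X ^ 2` and no constant term. -/
structure IsRankArray (φ : ℕ → ℕ → ℚ) : Prop where
  zero_zero : φ 0 0 = 1
  succ_zero : ∀ n, φ (n + 1) 0 = 0
  eq_zero : ∀ n s, n < s → φ n s = 0
  one : ∀ s, φ 1 (s + 1) - 2 * φ 1 (s + 2) + φ 1 (s + 3) = φ 0 s
  add_two : ∀ n s, φ (n + 2) (s + 1) - 2 * φ (n + 2) (s + 2) + φ (n + 2) (s + 3) =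
    φ (n + 1) s - φ n s

/-- Two sequences that vanish far out agree if their second differences agree. -/
theorem eq_of_second_difference {a b : ℕ → ℚ} {N : ℕ} (ha : ∀ s, N < s → a s = 0)
    (hb : ∀ s, N < s → b s = 0)
    (h : ∀ s, a (s + 1) - 2 * a (s + 2) + a (s + 3) = b (s + 1) - 2 * b (s + 2) + b (s + 3)) (s : ℕ) :
    a (s + 1) = b (s + 1) := by
  -- Downward induction on `s`: the entry at `s + 1` is determined by those at `s + 2` and `s + 3`,
  -- and `k` bounds the distance to the range where both sequences vanish.
  have key : ∀ k s, N < s + k → a (s + 1) = b (s + 1) := by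
    intro k
    induction k using Nat.strong_induction_on with
    | _ k ih =>
      intro s hs
      rcases k with _ | _ | k
      · rw [ha _ (by omega), hb _ (by omega)]
      · rw [ha _ (by omega), hb _ (by omega)]
      · have h1 := ih (k + 1) (by omega) (s + 1) (by omega)
        have h2 := ih k (by omega) (s + 2) (by omega)
        have h3 := h s
        rw [h1, show s + 3 = s + 2 + 1 from rfl, h2] at h3
        linarith
  exact key (N + 1) s (by omega)

/-- Each row is fixed by its entry in column `0`, its second differences (given by earlier rows) and
its vanishing beyond the diagonal. -/
theorem IsRankArray.unique {φ ψ : ℕ → ℕ → ℚ} (hφ : IsRankArray φ) (hψ : IsRankArray ψ) :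
    φ = ψ := by
  funext n
  induction n using Nat.strong_induction_on with
  | _ n ih =>
    funext s
    rcases n with _ | _ | n
    · rcases s with _ | s
      · rw [hφ.zero_zero, hψ.zero_zero]
      · rw [hφ.eq_zero _ _ (by omega), hψ.eq_zero _ _ (by omega)]
    · rcases s with _ | s
      · rw [hφ.succ_zero, hψ.succ_zero]
      · refine eq_of_second_difference (hφ.eq_zero 1) (hψ.eq_zero 1) (fun s => ?_) s
        rw [hφ.one, hψ.one, ih 0 (by omega)]
    · rcases s with _ | s
      · rw [hφ.succ_zero, hψ.succ_zero]
      · refine eq_of_second_difference (hφ.eq_zero (n + 2)) (hψ.eq_zero (n + 2)) (fun s => ?_) s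
        rw [hφ.add_two, hψ.add_two, ih n (by omega), ih (n + 1) (by omega)]

/-! ### The closed form -/

/-- The coefficient of `w ^ j` in `R ^ s`, where `R * (1 - R) ^ 2 = w`. -/
def ballotCoeff (j s : ℕ) : ℚ :=
  if j = 0 then (if s = 0 then 1 else 0)
  else if s ≤ j then (s : ℚ) / j * ((3 * j - s - 1).choose (j - s) : ℚ) else 0

theorem ballotCoeff_eq_zero {j s : ℕ} (h : j < s) : ballotCoeff j s = 0 := by
  unfold ballotCoeff
  split_ifs <;> first | rfl | omega

theorem ballotCoeff_succ_zero (j : ℕ) : ballotCoeff (j + 1) 0 = 0 := by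
  simp [ballotCoeff]

/-- Writing `j = s + 1 + k` removes the truncated subtractions and the case distinctions. -/
theorem ballotCoeff_add (s k : ℕ) :
    ballotCoeff (s + 1 + k) (s + 1) =
      ((s : ℚ) + 1) / (s + 1 + k) * ((2 * s + 3 * k + 1).choose k : ℚ) := by
  unfold ballotCoeff
  rw [if_neg (by omega), if_pos (by omega)]
  congr 3
  · push_cast; ring
  · push_cast; ring
  · omega
  · omega

theorem ballotCoeff_self (s : ℕ) : ballotCoeff s s = 1 := by
  rcases s with _ | s
  · simp [ballotCoeff]
  · have := ballotCoeff_add s 0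
    simp only [add_zero] at this
    rw [this]
    have : (s : ℚ) + 1 ≠ 0 := by positivity
    simp [this]

theorem ballotCoeff_zero_add (k : ℕ) : ballotCoeff (0 + k) 0 = if k = 0 then 1 else 0 := by
  rcases k with _ | k
  · simp [ballotCoeff]
  · simp [ballotCoeff]

theorem cast_choose_succ_succ_mul (n k : ℕ) :
    ((n + 1).choose (k + 1) : ℚ) = (n.choose k : ℚ) * (n + 1) / (k + 1) := by
  have h : (k : ℚ) + 1 ≠ 0 := by positivity
  rw [eq_div_iff h]
  have := Nat.add_one_mul_choose_eq n k
  have h2 : ((n + 1 : ℕ) : ℚ) * (n.choose k : ℚ) = ((n + 1).choose (k + 1) : ℚ) * ((k + 1 : ℕ) : ℚ) := by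
    exact_mod_cast this
  push_cast at h2
  linarith

theorem cast_choose_succ_mul (n k : ℕ) (hk : k ≤ n) :
    (n.choose (k + 1) : ℚ) = (n.choose k : ℚ) * (n - k) / (k + 1) := by
  have h : (k : ℚ) + 1 ≠ 0 := by positivity
  rw [eq_div_iff h]
  have := Nat.choose_succ_right_eq n k
  have h2 : (n.choose (k + 1) : ℚ) * ((k + 1 : ℕ) : ℚ) = (n.choose k : ℚ) * ((n - k : ℕ) : ℚ) := by
    exact_mod_cast this
  rw [Nat.cast_sub hk] at h2
  push_cast at h2
  linarith

/-- This is `R ^ s * (R * (1 - R) ^ 2) = w * R ^ s` read off at `w ^ (j + 1)`, verified as an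
identity of binomials. -/
theorem ballotCoeff_second_difference (j s : ℕ) :
    ballotCoeff (j + 1) (s + 1) - 2 * ballotCoeff (j + 1) (s + 2) + ballotCoeff (j + 1) (s + 3) =
      ballotCoeff j s := by
  rcases lt_or_ge j s with h | h
  · rw [ballotCoeff_eq_zero (by omega), ballotCoeff_eq_zero (by omega),
      ballotCoeff_eq_zero (by omega), ballotCoeff_eq_zero h]
    ring
  obtain ⟨k, rfl⟩ := Nat.exists_eq_add_of_le h
  -- For `j - s ≤ 1` some terms on the left lie beyond the diagonal and vanish; from `j - s = 2` on
  -- the general formula covers all three.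
  rcases k with _ | _ | k
  · rw [add_zero, ballotCoeff_self, ballotCoeff_self, ballotCoeff_eq_zero (by omega),
      ballotCoeff_eq_zero (by omega)]
    ring
  · have h1 := ballotCoeff_add s 1
    rw [show s + (0 + 1) + 1 = s + 1 + 1 by ring, h1, ballotCoeff_self,
      ballotCoeff_eq_zero (by omega)]
    rcases s with _ | s
    · simp [ballotCoeff]
      norm_num
    · rw [zero_add, ballotCoeff_add]
      simp only [Nat.choose_one_right]
      push_cast
      have : (s : ℚ) + 2 ≠ 0 := by positivity
      have : (s : ℚ) + 1 + 1 ≠ 0 := by positivity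
      have : (s : ℚ) + 1 + 1 + 1 ≠ 0 := by positivity
      field_simp
      ring
  · have h1 := ballotCoeff_add s (k + 2)
    have h2 := ballotCoeff_add (s + 1) (k + 1)
    have h3 := ballotCoeff_add (s + 2) k
    rw [show s + (k + 1 + 1) + 1 = s + 1 + (k + 2) by ring, h1,
      show s + 1 + (k + 2) = s + 1 + 1 + (k + 1) by ring, h2,
      show s + 1 + 1 + (k + 1) = s + 2 + 1 + k by ring, h3]
    -- All binomials become rational multiples of `(2 * s + 3 * k + 5).choose k`, which leaves a
    -- rational function identity.
    have e1 : ((2 * s + 3 * (k + 2) + 1).choose (k + 2) : ℚ) =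
        ((2 * s + 3 * k + 5).choose k : ℚ) * (2 * s + 3 * k + 6) / (k + 1) *
          (2 * s + 3 * k + 7) / (k + 2) := by
      have a := cast_choose_succ_succ_mul (2 * s + 3 * k + 6) (k + 1)
      have b := cast_choose_succ_succ_mul (2 * s + 3 * k + 5) k
      rw [show 2 * s + 3 * (k + 2) + 1 = 2 * s + 3 * k + 6 + 1 by ring,
        show k + 2 = k + 1 + 1 by ring, a, b]
      push_cast
      ring
    have e2 : ((2 * (s + 1) + 3 * (k + 1) + 1).choose (k + 1) : ℚ) =
        ((2 * s + 3 * k + 5).choose k : ℚ) * (2 * s + 3 * k + 6) / (k + 1) := by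
      have b := cast_choose_succ_succ_mul (2 * s + 3 * k + 5) k
      rw [show 2 * (s + 1) + 3 * (k + 1) + 1 = 2 * s + 3 * k + 5 + 1 by ring, b]
      push_cast
      ring
    have e3 : ((2 * s + 3 * k + 5).choose (k + 2) : ℚ) =
        ((2 * s + 3 * k + 5).choose k : ℚ) * (2 * s + 2 * k + 5) / (k + 1) *
          (2 * s + 2 * k + 4) / (k + 2) := by
      have a := cast_choose_succ_mul (2 * s + 3 * k + 5) (k + 1) (by omega)
      have b := cast_choose_succ_mul (2 * s + 3 * k + 5) k (by omega)
      rw [show k + 2 = k + 1 + 1 by ring, a, b]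
      push_cast
      ring
    rw [e1, e2, show 2 * (s + 2) + 3 * k + 1 = 2 * s + 3 * k + 5 by ring]
    rcases s with _ | s
    · have := ballotCoeff_zero_add (k + 1 + 1)
      rw [this, if_neg (by omega)]
      push_cast
      field_simp
      ring
    · rw [show s + 1 + (k + 1 + 1) = s + 1 + (k + 2) by ring, ballotCoeff_add,
        show 2 * s + 3 * (k + 2) + 1 = 2 * (s + 1) + 3 * k + 5 by ring, e3]
      push_cast
      have : (s : ℚ) + 1 + (k + 2) ≠ 0 := by positivity
      field_simp
      ring

/-- The coefficient of `Xⁿ` in `∑ⱼ ballotCoeff j s * (X - X ^ 2) ^ j`. -/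
def closedForm (n s : ℕ) : ℚ :=
  ∑ p ∈ Finset.HasAntidiagonal.antidiagonal n, (-1) ^ p.2 * ballotCoeff p.1 s * (p.1.choose p.2 : ℚ)

/-- Both sides are the coefficient of `X ^ (n + 1)` in `w * R ^ s` at `w = X - X ^ 2`; the upper
index `p.1 + 1` comes from the extra factor `w`. -/
theorem closedForm_second_difference (n s : ℕ) :
    closedForm (n + 1) (s + 1) - 2 * closedForm (n + 1) (s + 2) + closedForm (n + 1) (s + 3) =
      ∑ p ∈ Finset.HasAntidiagonal.antidiagonal n, (-1) ^ p.2 * ballotCoeff p.1 s * ((p.1 + 1).choose p.2 : ℚ) := by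
  simp only [closedForm, Finset.Nat.sum_antidiagonal_succ,
    ballotCoeff_eq_zero (Nat.succ_pos _), Finset.mul_sum, mul_zero, zero_mul, zero_add]
  rw [← Finset.sum_sub_distrib, ← Finset.sum_add_distrib]
  refine Finset.sum_congr rfl fun p _ => ?_
  rw [← ballotCoeff_second_difference p.1 s]
  ring

theorem isRankArray_closedForm : IsRankArray closedForm where
  zero_zero := by simp [closedForm, ballotCoeff]
  succ_zero n := by
    simp [closedForm, Finset.Nat.sum_antidiagonal_succ, ballotCoeff_succ_zero]
  eq_zero n s h := by
    refine Finset.sum_eq_zero fun p hp => ?_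
    rw [ballotCoeff_eq_zero]
    · simp
    · have := Finset.HasAntidiagonal.mem_antidiagonal.1 hp
      omega
  one s := by
    rw [closedForm_second_difference]
    simp [closedForm]
  add_two n s := by
    rw [closedForm_second_difference]
    simp only [closedForm]
    -- The terms with `p.2 = 0` agree. In the others Pascal's rule splits the binomial, which
    -- amounts to multiplying by `X - X ^ 2`.
    rw [Finset.Nat.sum_antidiagonal_succ', Finset.Nat.sum_antidiagonal_succ', add_sub_assoc,
      ← Finset.sum_sub_distrib]
    simp only [pow_zero, Nat.choose_zero_right]
    congr 1
    refine Finset.sum_congr rfl fun p _ => ?_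
    rw [Nat.choose_succ_succ]
    push_cast
    ring

theorem closedForm_eq_sum (n t : ℕ) :
    closedForm n (t + 1) =
      ∑ j ∈ Finset.Icc (t + 1) n,
        (-1 : ℚ) ^ (n - j) * (((t : ℚ) + 1) / (j : ℚ)) *
          ((3 * j - t - 2).choose (j - t - 1) : ℚ) * (j.choose (n - j) : ℚ) := by
  rw [closedForm, Finset.Nat.sum_antidiagonal_eq_sum_range_succ_mk]
  symm
  refine Finset.sum_subset_zero_on_sdiff ?_ ?_ ?_
  · intro j hj
    simp only [Finset.mem_Icc, Finset.mem_range] at *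
    omega
  · intro j hj
    simp only [Finset.mem_sdiff, Finset.mem_range, Finset.mem_Icc, not_and, not_le] at hj
    rw [ballotCoeff_eq_zero]
    · simp
    · by_contra hc
      have := hj.2 (by omega)
      omega
  · intro j hj
    simp only [Finset.mem_Icc] at hj
    rw [ballotCoeff, if_neg (by omega), if_pos hj.1,
      show 3 * j - (t + 1) - 1 = 3 * j - t - 2 by omega, show j - (t + 1) = j - t - 1 by omega]
    push_cast
    ring

/-! ### The power series -/

open PowerSeries in
-- The polynomial `X * (1 - X) ^ 2` has linear coefficient `1`, hence a compositional inverse;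
-- substituting `X - X ^ 2` into the inverse gives `P`.
theorem exists_rankSeries : ∃ P : PowerSeries ℚ, constantCoeff P = 0 ∧
    P * (1 - P) ^ 2 = X - X ^ 2 := by
  let q : Polynomial ℚ := Polynomial.X * (1 - Polynomial.X) ^ 2
  let p : PowerSeries ℚ := q
  have hp0 : constantCoeff p = 0 := by simp [p, q]
  have hp1 : coeff 1 p = 1 := by
    simp [p, q]
  let _ : Invertible (coeff 1 p) := hp1 ▸ invertibleOne
  have hs : HasSubst (substInv p) := HasSubst.substInv p
  have hw : constantCoeff (X - X ^ 2 : PowerSeries ℚ) = 0 := by simp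
  have hw' : HasSubst (X - X ^ 2 : PowerSeries ℚ) := HasSubst.of_constantCoeff_zero' hw
  have h := subst_substInv_right p hp0
  have h1 : substInv p * (1 - substInv p) ^ 2 = X := by
    rw [← h, subst_coe hs]
    simp [q]
  refine ⟨(substInv p).subst (X - X ^ 2 : PowerSeries ℚ), ?_, ?_⟩
  · exact constantCoeff_subst_eq_zero hw _ (constantCoeff_substInv p)
  · have h2 := congrArg (substAlgHom hw') h1
    simp only [map_mul, map_pow, map_sub, map_one, substAlgHom_X] at h2
    simpa [coe_substAlgHom] using h2

open PowerSeries in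
theorem isRankArray_coeff_pow {P : PowerSeries ℚ} (h0 : constantCoeff P = 0)
    (hP : P * (1 - P) ^ 2 = X - X ^ 2) : IsRankArray fun n s => coeff n (P ^ s) := by
  have key : ∀ s, P ^ (s + 1) - 2 * P ^ (s + 2) + P ^ (s + 3) = X * (P ^ s - X * P ^ s) := by
    intro s
    calc _ = P ^ s * (P * (1 - P) ^ 2) := by ring
      _ = _ := by rw [hP]; ring
  have key' : ∀ n s, coeff n (P ^ (s + 1)) - 2 * coeff n (P ^ (s + 2)) + coeff n (P ^ (s + 3)) =
      coeff n (X * (P ^ s - X * P ^ s)) := by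
    intro n s
    rw [← key, map_add, map_sub]
    congr 2
    rw [two_mul, two_mul, map_add]
  refine ⟨by simp, fun n => by simp [coeff_one], fun n s h => ?_, fun s => ?_, fun n s => ?_⟩
  · obtain ⟨Q, rfl⟩ := X_dvd_iff.2 h0
    rw [mul_pow, coeff_X_pow_mul', if_neg (by omega)]
  · rw [key', show (1 : ℕ) = 0 + 1 from rfl, coeff_succ_X_mul]
    simp
  · rw [key', show n + 2 = n + 1 + 1 from rfl, coeff_succ_X_mul, map_sub, coeff_succ_X_mul]

/-! ### Inversion sequences as functions on the natural numbers -/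

/-- The `102`-avoiding inversion sequences of length `n`, extended by zero. -/
def AvoidingSeq (n : ℕ) : Set (ℕ → ℕ) :=
  {e | (∀ i, e i ≤ i) ∧ (∀ i, n ≤ i → e i = 0) ∧
    ∀ i j k, i < j → j < k → e j < e i → e k ≤ e i}

/-- Insert the entry `m` at position `q`. -/
def insertEntry (q m : ℕ) (e : ℕ → ℕ) : ℕ → ℕ :=
  fun i => if i < q then e i else if i = q then m else e (i - 1)

/-- Delete the entry at position `q`. -/
def deleteEntry (q : ℕ) (e : ℕ → ℕ) : ℕ → ℕ :=
  fun i => if i < q then e i else e (i + 1)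

/-- The largest value of a bounded sequence. -/
noncomputable def topValue (e : ℕ → ℕ) : ℕ := sSup (Set.range e)

theorem topValue_eq {e : ℕ → ℕ} {M i : ℕ} (h : ∀ i, e i ≤ M) (hi : e i = M) : topValue e = M := by
  apply le_antisymm
  · exact csSup_le ⟨_, i, rfl⟩ (by rintro _ ⟨j, rfl⟩; exact h j)
  · exact le_csSup ⟨M, by rintro _ ⟨j, rfl⟩; exact h j⟩ ⟨i, hi⟩

theorem insertEntry_of_lt {q m i : ℕ} (e : ℕ → ℕ) (h : i < q) : insertEntry q m e i = e i :=
  if_pos h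

theorem insertEntry_self (q m : ℕ) (e : ℕ → ℕ) : insertEntry q m e q = m := by
  simp [insertEntry]

theorem insertEntry_succ {q m i : ℕ} (e : ℕ → ℕ) (h : q ≤ i) :
    insertEntry q m e (i + 1) = e i := by
  rw [insertEntry, if_neg (by omega), if_neg (by omega), Nat.add_sub_cancel]

theorem insertEntry_le {q m M : ℕ} {e : ℕ → ℕ} (hm : m ≤ M) (h : ∀ i, e i ≤ M) (i : ℕ) :
    insertEntry q m e i ≤ M := by
  unfold insertEntry
  split_ifs <;> first | exact hm | exact h _

theorem deleteEntry_of_lt {q i : ℕ} (e : ℕ → ℕ) (h : i < q) : deleteEntry q e i = e i :=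
  if_pos h

theorem deleteEntry_of_le {q i : ℕ} (e : ℕ → ℕ) (h : q ≤ i) : deleteEntry q e i = e (i + 1) :=
  if_neg (by omega)

theorem deleteEntry_le {q M : ℕ} {e : ℕ → ℕ} (h : ∀ i, e i ≤ M) (i : ℕ) :
    deleteEntry q e i ≤ M := by
  unfold deleteEntry
  split_ifs <;> exact h _

theorem deleteEntry_insertEntry (q m : ℕ) (e : ℕ → ℕ) :
    deleteEntry q (insertEntry q m e) = e := by
  funext i
  rcases lt_or_ge i q with h | h
  · rw [deleteEntry_of_lt _ h, insertEntry_of_lt _ h]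
  · rw [deleteEntry_of_le _ h, insertEntry_succ _ h]

theorem insertEntry_deleteEntry (q : ℕ) (e : ℕ → ℕ) :
    insertEntry q (e q) (deleteEntry q e) = e := by
  funext i
  rcases lt_trichotomy i q with h | rfl | h
  · rw [insertEntry_of_lt _ h, deleteEntry_of_lt _ h]
  · rw [insertEntry_self]
  · obtain ⟨i, rfl⟩ := Nat.exists_eq_add_of_le' (Nat.one_le_of_lt h)
    rw [insertEntry_succ _ (by omega), deleteEntry_of_le _ (by omega)]

/-- Entries behind position `q` move one place to the left, but they are at most `e q ≤ q`, so the
bound `e i ≤ i` survives. -/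
theorem deleteEntry_mem {n q : ℕ} {e : ℕ → ℕ} (he : e ∈ AvoidingSeq (n + 1)) (hq : q ≤ n)
    (hmax : ∀ i, e i ≤ e q) : deleteEntry q e ∈ AvoidingSeq n := by
  obtain ⟨h1, h2, h3⟩ := he
  refine ⟨fun i => ?_, fun i hi => ?_, fun i j k hij hjk => ?_⟩
  · rcases lt_or_ge i q with h | h
    · rw [deleteEntry_of_lt _ h]; exact h1 i
    · rw [deleteEntry_of_le _ h]; exact (hmax _).trans ((h1 q).trans h)
  · rw [deleteEntry_of_le _ (by omega)]; exact h2 _ (by omega)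
  · unfold deleteEntry
    split_ifs <;> first | omega | exact h3 _ _ _ (by omega) (by omega)

/-- An inserted maximum can only play the `2` of a pattern `102`, and that requires a descent before
it, which monotonicity up to `q` excludes. -/
theorem insertEntry_mem {n q m : ℕ} {e : ℕ → ℕ} (he : e ∈ AvoidingSeq n) (hq : q ≤ n) (hm : m ≤ q)
    (hmax : ∀ i, e i ≤ m) (hmono : ∀ i j, i ≤ j → j < q → e i ≤ e j) :
    insertEntry q m e ∈ AvoidingSeq (n + 1) := by
  obtain ⟨h1, h2, h3⟩ := he
  refine ⟨fun i => ?_, fun i hi => ?_, fun i j k hij hjk => ?_⟩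
  · rcases lt_trichotomy i q with h | rfl | h
    · rw [insertEntry_of_lt _ h]; exact h1 i
    · rw [insertEntry_self]; exact hm
    · exact (insertEntry_le le_rfl hmax i).trans (hm.trans h.le)
  · obtain ⟨i, rfl⟩ := Nat.exists_eq_add_of_le' (show 1 ≤ i by omega)
    rw [insertEntry_succ _ (by omega)]; exact h2 _ (by omega)
  · intro hlt
    rcases lt_trichotomy k q with hk | rfl | hk
    · rw [insertEntry_of_lt _ hk, insertEntry_of_lt _ (by omega)]
      rw [insertEntry_of_lt _ (by omega), insertEntry_of_lt _ (by omega)] at hlt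
      exact h3 _ _ _ hij hjk hlt
    · rw [insertEntry_of_lt _ (by omega), insertEntry_of_lt _ (by omega)] at hlt
      exact absurd (hmono i j hij.le hjk) (by omega)
    · rcases eq_or_ne i q with rfl | hi
      · rw [insertEntry_self]
        exact insertEntry_le le_rfl hmax _
      rcases eq_or_ne j q with rfl | hj
      · rw [insertEntry_self] at hlt
        exact absurd (insertEntry_le (q := j) le_rfl hmax i) (by omega)
      · unfold insertEntry at hlt ⊢
        split_ifs at hlt ⊢ <;> first | omega | exact h3 _ _ _ (by omega) (by omega) hlt

/-- As for insertion: the new value is a maximum preceded by a weakly increasing run, so it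
completes no `102`. -/
theorem update_mem {n q m : ℕ} {e : ℕ → ℕ} (he : e ∈ AvoidingSeq n) (hq : q < n) (hm : m ≤ q)
    (hmax : ∀ i, i ≠ q → e i ≤ m) (hmono : ∀ i j, i ≤ j → j < q → e i ≤ e j) :
    Function.update e q m ∈ AvoidingSeq n := by
  obtain ⟨h1, h2, h3⟩ := he
  have hle : ∀ i, Function.update e q m i ≤ m := by
    intro i
    rcases eq_or_ne i q with rfl | h
    · simp
    · rw [Function.update_of_ne h]; exact hmax i h
  refine ⟨fun i => ?_, fun i hi => ?_, fun i j k hij hjk hlt => ?_⟩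
  · rcases eq_or_ne i q with rfl | h
    · simpa using hm
    · rw [Function.update_of_ne h]; exact h1 i
  · rw [Function.update_of_ne (by omega)]; exact h2 i hi
  · rcases eq_or_ne i q with rfl | hi
    · rw [Function.update_self]; exact hle k
    rcases eq_or_ne j q with rfl | hj
    · rw [Function.update_self] at hlt
      exact absurd (hle i) (by omega)
    rw [Function.update_of_ne hi, Function.update_of_ne hj] at hlt
    rw [Function.update_of_ne hi]
    rcases eq_or_ne k q with rfl | hk
    · exact absurd (hmono i j hij.le hjk) (by omega)
    · rw [Function.update_of_ne hk]; exact h3 i j k hij hjk hlt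

theorem finite_avoidingSeq (n : ℕ) : (AvoidingSeq n).Finite := by
  have h : (Set.pi Set.univ fun i : Fin n => Set.Iic (i : ℕ)).Finite :=
    Set.Finite.pi fun i => Set.finite_Iic _
  refine Set.Finite.of_finite_image (f := fun e (i : Fin n) => e i) (h.subset ?_) ?_
  · rintro _ ⟨e, he, rfl⟩ i -
    exact he.1 i
  · intro e he e' he' hee
    funext i
    rcases lt_or_ge i n with hi | hi
    · exact congrFun hee ⟨i, hi⟩
    · rw [he.2.1 i hi, he'.2.1 i hi]

/-! ### Sequences classified by rank -/

/-- The sequences of `AvoidingSeq n` with largest value `M` that are weakly increasing on their first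
`M + s` entries, that is, whose rank is at least `s - 1`. -/
def RankGe (n s : ℕ) : Set (ℕ → ℕ) :=
  {e | e ∈ AvoidingSeq n ∧ ∃ M, (∀ i, e i ≤ M) ∧ (∃ i, e i = M) ∧ M + s ≤ n ∧
    ∀ i j, i ≤ j → j < M + s → e i ≤ e j}

/-- The sequences of `RankGe n (t + 1)` whose entry at position `M + t` is the largest value `M`. -/
def MaxAt (n t : ℕ) : Set (ℕ → ℕ) :=
  {e | e ∈ AvoidingSeq n ∧ ∃ M, (∀ i, e i ≤ M) ∧ e (M + t) = M ∧ M + t < n ∧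
    ∀ i j, i ≤ j → j ≤ M + t → e i ≤ e j}

/-- The sequences of `RankGe n s` whose rank is exactly `s - 1`. -/
def RankEq (n s : ℕ) : Set (ℕ → ℕ) := RankGe n s \ RankGe n (s + 1)

theorem finite_rankGe (n s : ℕ) : (RankGe n s).Finite :=
  (finite_avoidingSeq n).subset fun _ h => h.1

theorem finite_maxAt (n s : ℕ) : (MaxAt n s).Finite :=
  (finite_avoidingSeq n).subset fun _ h => h.1

theorem rankGe_succ_subset (n s : ℕ) : RankGe n (s + 1) ⊆ RankGe n s := by
  rintro e ⟨he, M, h1, h2, h3, h4⟩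
  exact ⟨he, M, h1, h2, by omega, fun i j hij hj => h4 i j hij (by omega)⟩

theorem rankGe_eq_empty {n s : ℕ} (h : n < s) : RankGe n s = ∅ := by
  rw [Set.eq_empty_iff_forall_notMem]
  rintro e ⟨_, M, _, _, h3, _⟩
  omega

theorem maxAt_zero (t : ℕ) : MaxAt 0 t = ∅ := by
  rw [Set.eq_empty_iff_forall_notMem]
  rintro e ⟨_, M, _, _, h3, _⟩
  omega

theorem rankGe_zero_zero : RankGe 0 0 = {0} := by
  ext e
  constructor
  · rintro ⟨he, -⟩
    funext i
    exact he.2.1 i (Nat.zero_le i)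
  · rintro rfl
    exact ⟨⟨fun i => Nat.zero_le i, fun _ _ => rfl, fun _ _ _ _ _ _ => le_rfl⟩, 0,
      fun _ => le_rfl, ⟨0, rfl⟩, le_rfl, fun _ _ _ _ => le_rfl⟩

/-- The rank is never negative: the value `M` occurs at some position `k ≥ M`, so a drop from an
earlier entry to the one at position `M` would form a `102` with that occurrence. -/
theorem rankGe_succ_zero (n : ℕ) : RankGe (n + 1) 0 = RankGe (n + 1) 1 := by
  refine Set.Subset.antisymm ?_ (rankGe_succ_subset _ _)
  rintro e ⟨he, M, h1, ⟨k, hk⟩, h3, h4⟩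
  obtain ⟨b, z, av⟩ := he
  have hMk : M ≤ k := hk ▸ b k
  have hMn : M ≤ n := by
    by_contra hc
    have := z k (by omega)
    omega
  refine ⟨⟨b, z, av⟩, M, h1, ⟨k, hk⟩, by omega, fun i j hij hj => ?_⟩
  rcases eq_or_ne j M with rfl | hjM
  · rcases eq_or_ne i j with rfl | hne
    · exact le_rfl
    by_contra! hlt
    have hi : e i ≤ i := b i
    rcases eq_or_ne k j with rfl | hkj
    · omega
    · have := av i j k (by omega) (by omega) hlt
      omega
  · exact h4 i j hij (by omega)

/-! ### Bijections that delete or lower a maximum, and the resulting recurrence -/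

theorem Set.ncard_eq_of_inverse {α β : Type*} {s : Set α} {t : Set β} (f : α → β) (g : β → α)
    (hf : ∀ a ∈ s, f a ∈ t ∧ g (f a) = a) (hg : ∀ b ∈ t, g b ∈ s ∧ f (g b) = b) :
    s.ncard = t.ncard :=
  (Set.InvOn.bijOn (f' := g) ⟨fun a ha => (hf a ha).2, fun b hb => (hg b hb).2⟩
    (fun a ha => (hf a ha).1) fun b hb => (hg b hb).1).ncard_eq

/-- Deleting the copy of `M` at position `M + s` keeps the largest value, because another copy
remains. For `M = 0` the padding zeros count as further copies. -/
theorem ncard_maxAt_repeated (n s : ℕ) :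
    {e ∈ MaxAt (n + 1) s | ∃ i, i ≠ topValue e + s ∧ e i = topValue e}.ncard =
      (RankGe n s).ncard := by
  refine Set.ncard_eq_of_inverse (fun e => deleteEntry (topValue e + s) e)
    (fun e => insertEntry (topValue e + s) (topValue e) e) ?_ ?_
  · rintro e ⟨⟨he, M, h1, h2, h3, h4⟩, i, hi, hiM⟩
    have hM := topValue_eq h1 h2
    simp only [hM] at hi hiM ⊢
    have h1' : ∀ j, deleteEntry (M + s) e j ≤ M := deleteEntry_le h1
    have h2' : ∃ j, deleteEntry (M + s) e j = M := by
      rcases lt_or_gt_of_ne hi with h | h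
      · exact ⟨i, by rw [deleteEntry_of_lt _ h, hiM]⟩
      · refine ⟨i - 1, ?_⟩
        rw [deleteEntry_of_le _ (by omega), Nat.sub_add_cancel (by omega), hiM]
    refine ⟨⟨deleteEntry_mem he (by omega) fun j => by rw [h2]; exact h1 j, M, h1', h2', by omega,
      fun a b hab hb => ?_⟩, ?_⟩
    · rw [deleteEntry_of_lt _ hb, deleteEntry_of_lt _ (by omega)]
      exact h4 a b hab hb.le
    · obtain ⟨j, hj⟩ := h2'
      rw [topValue_eq h1' hj]
      nth_rw 2 [← h2]
      exact insertEntry_deleteEntry _ _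
  · rintro e ⟨he, M, h1, ⟨i, hi⟩, h3, h4⟩
    have hM := topValue_eq h1 hi
    simp only [hM]
    have h1' : ∀ j, insertEntry (M + s) M e j ≤ M := insertEntry_le le_rfl h1
    have h2' := insertEntry_self (M + s) M e
    rw [topValue_eq h1' h2']
    refine ⟨⟨⟨insertEntry_mem he h3 (by omega) h1 h4, M, h1', h2', by omega,
      fun a b hab hb => ?_⟩, ?_⟩, deleteEntry_insertEntry _ _ _⟩
    · rcases eq_or_ne b (M + s) with rfl | hne
      · rw [h2']; exact h1' a
      · rw [insertEntry_of_lt _ (by omega), insertEntry_of_lt _ (by omega)]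
        exact h4 a b hab (by omega)
    · rcases lt_or_ge i (M + s) with h | h
      · exact ⟨i, by rw [topValue_eq h1' h2']; omega, by rw [insertEntry_of_lt _ h, hi]; exact (topValue_eq h1' h2').symm⟩
      · exact ⟨i + 1, by rw [topValue_eq h1' h2']; omega,
          by rw [insertEntry_succ _ h, hi]; exact (topValue_eq h1' h2').symm⟩

/-- A unique maximum `M` is lowered to `M - 1`. It stays in place, and `M + s = (M - 1) + (s + 1)`,
so the second index grows by one. -/
theorem ncard_maxAt_single (n s : ℕ) :
    {e ∈ MaxAt (n + 1) s | ¬ ∃ i, i ≠ topValue e + s ∧ e i = topValue e}.ncard =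
      (MaxAt (n + 1) (s + 1)).ncard := by
  refine Set.ncard_eq_of_inverse
    (fun e => Function.update e (topValue e + s) (topValue e - 1))
    (fun e => Function.update e (topValue e + (s + 1)) (topValue e + 1)) ?_ ?_
  · rintro e ⟨⟨he, M, h1, h2, h3, h4⟩, hne⟩
    have hM := topValue_eq h1 h2
    simp only [hM] at hne ⊢
    push Not at hne
    have hlt : ∀ i, i ≠ M + s → e i ≤ M - 1 := fun i hi =>
      Nat.le_sub_one_of_lt (lt_of_le_of_ne (h1 i) (hne i hi))
    -- Uniqueness forces `M > 0`, since the next entry (possibly padding) is strictly smaller.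
    obtain ⟨m, rfl⟩ : ∃ m, M = m + 1 := by
      refine ⟨M - 1, ?_⟩
      have := hne (M + s + 1) (by omega)
      have := h1 (M + s + 1)
      omega
    rw [Nat.add_sub_cancel] at hlt ⊢
    have h1' : ∀ i, Function.update e (m + 1 + s) m i ≤ m := by
      intro i
      rcases eq_or_ne i (m + 1 + s) with rfl | h
      · simp
      · rw [Function.update_of_ne h]; exact hlt i h
    have h2' : Function.update e (m + 1 + s) m (m + (s + 1)) = m := by
      rw [show m + (s + 1) = m + 1 + s by ring, Function.update_self]
    refine ⟨⟨update_mem he h3 (by omega) hlt fun i j hij hj => h4 i j hij hj.le, m, h1', h2',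
      by omega, fun i j hij hj => ?_⟩, ?_⟩
    · rcases eq_or_ne j (m + 1 + s) with rfl | h
      · rw [Function.update_self]; exact h1' i
      · rw [Function.update_of_ne h, Function.update_of_ne (by omega)]
        exact h4 i j hij (by omega)
    · rw [topValue_eq h1' h2', show m + (s + 1) = m + 1 + s by ring, Function.update_idem]
      exact Function.update_eq_iff.2 ⟨h2.symm, fun _ _ => rfl⟩
  · rintro e ⟨he, M, h1, h2, h3, h4⟩
    have hM := topValue_eq h1 h2
    simp only [hM]
    have h1' : ∀ i, Function.update e (M + (s + 1)) (M + 1) i ≤ M + 1 := by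
      intro i
      rcases eq_or_ne i (M + (s + 1)) with rfl | h
      · simp
      · rw [Function.update_of_ne h]; exact (h1 i).trans (Nat.le_succ M)
    have h2' : Function.update e (M + (s + 1)) (M + 1) (M + 1 + s) = M + 1 := by
      rw [show M + 1 + s = M + (s + 1) by ring, Function.update_self]
    have hM' := topValue_eq h1' h2'
    refine ⟨⟨⟨update_mem he h3 (by omega) (fun i _ => (h1 i).trans (Nat.le_succ M))
      fun i j hij hj => h4 i j hij hj.le, M + 1, h1', h2', by omega, fun i j hij hj => ?_⟩, ?_⟩, ?_⟩
    · rcases eq_or_ne j (M + (s + 1)) with rfl | h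
      · rw [Function.update_self]; exact h1' i
      · rw [Function.update_of_ne h, Function.update_of_ne (by omega)]
        exact h4 i j hij (by omega)
    · rw [hM']
      rintro ⟨i, hi, hiM⟩
      rw [Function.update_of_ne (by omega)] at hiM
      have := h1 i
      omega
    · rw [hM', show M + 1 + s = M + (s + 1) by ring, Function.update_idem, Nat.add_sub_cancel]
      exact Function.update_eq_iff.2 ⟨h2.symm, fun _ _ => rfl⟩

/-- One of two adjacent copies of `M` is deleted. The bound `topValue e + t < n` keeps a padding
zero from passing as the second copy when `M = 0`. -/
theorem ncard_maxAt_plateau (n t : ℕ) :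
    {e ∈ MaxAt (n + 1) t | topValue e + t < n ∧ e (topValue e + t + 1) = topValue e}.ncard =
      (MaxAt n t).ncard := by
  refine Set.ncard_eq_of_inverse (fun e => deleteEntry (topValue e + t) e)
    (fun e => insertEntry (topValue e + t) (topValue e) e) ?_ ?_
  · rintro e ⟨⟨he, M, h1, h2, h3, h4⟩, hn, hM'⟩
    have hM := topValue_eq h1 h2
    simp only [hM] at hn hM' ⊢
    have h1' : ∀ j, deleteEntry (M + t) e j ≤ M := deleteEntry_le h1
    have h2' : deleteEntry (M + t) e (M + t) = M := by
      rw [deleteEntry_of_le _ le_rfl, hM']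
    refine ⟨⟨deleteEntry_mem he (by omega) fun j => by rw [h2]; exact h1 j, M, h1', h2', hn,
      fun a b hab hb => ?_⟩, ?_⟩
    · rcases eq_or_ne b (M + t) with rfl | hne
      · rw [h2']; exact h1' a
      · rw [deleteEntry_of_lt _ (by omega), deleteEntry_of_lt _ (by omega)]
        exact h4 a b hab hb
    · rw [topValue_eq h1' h2']
      nth_rw 2 [← h2]
      exact insertEntry_deleteEntry _ _
  · rintro e ⟨he, M, h1, h2, h3, h4⟩
    have hM := topValue_eq h1 h2
    simp only [hM]
    have h1' : ∀ j, insertEntry (M + t) M e j ≤ M := insertEntry_le le_rfl h1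
    have h2' := insertEntry_self (M + t) M e
    have hM' := topValue_eq h1' h2'
    rw [hM']
    refine ⟨⟨⟨insertEntry_mem he h3.le (by omega) h1 fun i j hij hj => h4 i j hij hj.le, M, h1', h2',
      by omega, fun a b hab hb => ?_⟩, ?_⟩, deleteEntry_insertEntry _ _ _⟩
    · rcases eq_or_ne b (M + t) with rfl | hne
      · rw [h2']; exact h1' a
      · rw [insertEntry_of_lt _ (by omega), insertEntry_of_lt _ (by omega)]
        exact h4 a b hab (by omega)
    · rw [hM']
      exact ⟨h3, by rw [insertEntry_succ _ le_rfl, h2]⟩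

theorem ncard_sep_add_ncard_sep_not {α : Type*} {s : Set α} (hs : s.Finite) (p : α → Prop) :
    {a ∈ s | p a}.ncard + {a ∈ s | ¬ p a}.ncard = s.ncard := by
  rw [← Set.ncard_union_eq _ (hs.subset fun _ h => h.1) (hs.subset fun _ h => h.1)]
  · congr 1
    ext a
    simp only [Set.mem_union, Set.mem_ofPred_eq]
    tauto
  · rw [Set.disjoint_left]
    exact fun a h h' => h'.2 h.2

theorem ncard_maxAt_eq_add_rankGe (n s : ℕ) :
    (MaxAt (n + 1) s).ncard = (MaxAt (n + 1) (s + 1)).ncard + (RankGe n s).ncard := by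
  rw [← ncard_maxAt_repeated, ← ncard_maxAt_single, ← ncard_sep_add_ncard_sep_not
    (finite_maxAt (n + 1) s) fun e => ∃ i, i ≠ topValue e + s ∧ e i = topValue e]
  exact Nat.add_comm _ _

/-- Without a second copy of `M` next to it, the increasing run stops at position `M + t`, so the
rank is exactly `t`. Conversely, rank `t` forces the entry there to be `M`: a later `M` would form a
`102` with the descent just after position `M + t`. -/
theorem maxAt_not_plateau (n t : ℕ) :
    {e ∈ MaxAt (n + 1) t | ¬ (topValue e + t < n ∧ e (topValue e + t + 1) = topValue e)} =
      RankEq (n + 1) (t + 1) := by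
  ext e
  constructor
  · rintro ⟨⟨he, M, h1, h2, h3, h4⟩, hn⟩
    have hM := topValue_eq h1 h2
    rw [hM] at hn
    refine ⟨⟨he, M, h1, ⟨_, h2⟩, h3, fun i j hij hj => h4 i j hij (by omega)⟩, ?_⟩
    rintro ⟨-, M', h1', ⟨k, hk⟩, h3', h4'⟩
    have : M' = M := by rw [← topValue_eq h1' hk, hM]
    subst this
    refine hn ⟨by omega, le_antisymm (h1 _) ?_⟩
    have := h4' (M' + t) (M' + t + 1) (by omega) (by omega)
    omega
  · rintro ⟨⟨he, M, h1, ⟨k, hk⟩, h3, h4⟩, hn⟩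
    have hM := topValue_eq h1 hk
    have hdesc : M + t < n → e (M + t + 1) < e (M + t) := by
      intro hlt
      by_contra! hc
      refine hn ⟨he, M, h1, ⟨k, hk⟩, by omega, fun i j hij hj => ?_⟩
      rcases eq_or_ne j (M + t + 1) with rfl | hne
      · rcases eq_or_ne i (M + t + 1) with rfl | hne'
        · exact le_rfl
        · exact (h4 i (M + t) (by omega) (by omega)).trans hc
      · exact h4 i j hij (by omega)
    have hMt : e (M + t) = M := by
      refine le_antisymm (h1 _) ?_
      rcases le_or_gt k (M + t) with hle | hlt
      · rw [← hk]; exact hk ▸ h4 k (M + t) hle (by omega)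
      · obtain ⟨b, z, av⟩ := he
        rcases Nat.eq_zero_or_pos M with h0 | hpos
        · omega
        have hkn : k < n + 1 := by
          by_contra! hc
          have := z k hc
          omega
        have hd := hdesc (by omega)
        rcases eq_or_ne k (M + t + 1) with rfl | hne
        · omega
        · have := av (M + t) (M + t + 1) k (by omega) (by omega) hd
          omega
    refine ⟨⟨he, M, h1, hMt, by omega, fun i j hij hj => h4 i j hij (by omega)⟩, ?_⟩
    rw [hM]
    rintro ⟨hlt, heq⟩
    have := hdesc hlt
    omega

theorem ncard_maxAt_eq_add_rankEq (n t : ℕ) :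
    (MaxAt (n + 1) t).ncard = (MaxAt n t).ncard + (RankEq (n + 1) (t + 1)).ncard := by
  rw [← ncard_maxAt_plateau n t, ← maxAt_not_plateau, ncard_sep_add_ncard_sep_not
    (finite_maxAt _ _)]

theorem ncard_rankGe_eq (n s : ℕ) :
    (RankGe n s).ncard = (RankGe n (s + 1)).ncard + (RankEq n s).ncard := by
  rw [add_comm, RankEq, Set.ncard_sdiff_add_ncard_of_subset (rankGe_succ_subset n s)
    (finite_rankGe n s)]

/-- By the plateau relation, entry `s + 1` of a row is a difference of `MaxAt` counts for
consecutive lengths. The first difference of `MaxAt` in `s` is `RankGe` one length lower, and the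
first difference of `RankGe` is `RankEq`. -/
theorem isRankArray_ncard_rankEq : IsRankArray fun n s => ((RankEq n s).ncard : ℚ) where
  zero_zero := by
    rw [RankEq, rankGe_zero_zero, rankGe_eq_empty (by omega : 0 < 0 + 1)]
    simp
  succ_zero n := by
    rw [RankEq, rankGe_succ_zero]
    simp
  eq_zero n s h := by
    rw [RankEq, rankGe_eq_empty h]
    simp
  one s := by
    have a := fun s => ncard_maxAt_eq_add_rankEq 0 s
    have b := fun s => ncard_maxAt_eq_add_rankGe 0 s
    simp only [maxAt_zero, Set.ncard_empty, zero_add] at a b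
    have c := ncard_rankGe_eq 0 s
    have h0 := b s
    have h1 := b (s + 1)
    rw [a, a] at h0 h1
    qify at c h0 h1
    simp only [add_assoc, Nat.reduceAdd] at c h0 h1
    linarith
  add_two n s := by
    have a := fun s => ncard_maxAt_eq_add_rankEq (n + 1) s
    have a' := a s
    have a1 := a (s + 1)
    have a2 := a (s + 2)
    have b := fun n s => ncard_maxAt_eq_add_rankGe n s
    have b0 := b n s
    have b1 := b n (s + 1)
    have b2 := b (n + 1) s
    have b3 := b (n + 1) (s + 1)
    have c := ncard_rankGe_eq n s
    have c' := ncard_rankGe_eq (n + 1) s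
    qify at a' a1 a2 b0 b1 b2 b3 c c'
    simp only [add_assoc, Nat.reduceAdd] at a' a1 a2 b0 b1 b2 b3 c c' ⊢
    linarith

/-! ### Comparison with the inversion sequences of the statement -/

theorem wordReduction_le {k : ℕ} {w : Fin k → ℕ} {a b : Fin k} (h : w a ≤ w b) :
    wordReduction w a ≤ wordReduction w b := by
  refine Finset.card_le_card fun x hx => ?_
  simp only [Finset.mem_filter] at hx ⊢
  exact ⟨hx.1, hx.2.trans_le h⟩

theorem wordReduction_eq_102 (w : Fin 3 → ℕ) :
    wordReduction w = ![1, 0, 2] ↔ w 1 < w 0 ∧ w 0 < w 2 := by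
  constructor
  · intro h
    have h0 : wordReduction w 0 = 1 := by rw [h]; rfl
    have h1 : wordReduction w 1 = 0 := by rw [h]; rfl
    have h2 : wordReduction w 2 = 2 := by rw [h]; rfl
    constructor
    · by_contra! hc
      have := wordReduction_le hc
      omega
    · by_contra! hc
      have := wordReduction_le hc
      omega
  · rintro ⟨h1, h2⟩
    have himg : Finset.univ.image w = {w 0, w 1, w 2} := by
      ext x
      simp [Fin.exists_fin_succ, eq_comm]
    funext a
    rw [wordReduction, himg]
    fin_cases a
    · have : ({w 0, w 1, w 2} : Finset ℕ).filter (fun x => x < w 0) = {w 1} := by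
        ext x
        simp only [Finset.mem_filter, Finset.mem_insert, Finset.mem_singleton]
        omega
      simp [this]
    · have : ({w 0, w 1, w 2} : Finset ℕ).filter (fun x => x < w 1) = ∅ := by
        ext x
        simp only [Finset.mem_filter, Finset.mem_insert, Finset.mem_singleton, Finset.notMem_empty, iff_false]
        omega
      simp [this]
    · have : ({w 0, w 1, w 2} : Finset ℕ).filter (fun x => x < w 2) = {w 0, w 1} := by
        ext x
        simp only [Finset.mem_filter, Finset.mem_insert, Finset.mem_singleton]
        omega
      simp [this, Finset.card_pair h1.ne']

theorem avoidsPattern_102_iff {n : ℕ} (e : Fin n → ℕ) :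
    AvoidsPattern e ![1, 0, 2] ↔ ∀ a b c, a < b → b < c → e b < e a → e c ≤ e a := by
  unfold AvoidsPattern ContainsPattern
  constructor
  · intro h a b c hab hbc hlt
    by_contra! hc
    refine h ⟨![a, b, c], ?_, (wordReduction_eq_102 _).2 ⟨hlt, hc⟩⟩
    intro i j hij
    fin_cases i <;> fin_cases j <;> simp_all
    exact hab.trans hbc
  · rintro h ⟨i, hi, hw⟩
    obtain ⟨h1, h2⟩ := (wordReduction_eq_102 _).1 hw
    have := h (i 0) (i 1) (i 2) (hi (by decide)) (hi (by decide)) h1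
    simp only [Function.comp_apply] at h2
    omega

/-- Extend a finite sequence by zero. -/
def extendZero {n : ℕ} (e : Fin n → ℕ) : ℕ → ℕ :=
  fun i => if h : i < n then e ⟨i, h⟩ else 0

theorem extendZero_of_lt {n : ℕ} (e : Fin n → ℕ) {i : ℕ} (h : i < n) :
    extendZero e i = e ⟨i, h⟩ := dif_pos h

theorem extendZero_of_le {n : ℕ} (e : Fin n → ℕ) {i : ℕ} (h : n ≤ i) : extendZero e i = 0 :=
  dif_neg (by omega)

theorem extendZero_val {n : ℕ} (e : Fin n → ℕ) (i : Fin n) : extendZero e i = e i :=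
  extendZero_of_lt e i.2

theorem extendZero_restrict {n : ℕ} {b : ℕ → ℕ} (h : ∀ i, n ≤ i → b i = 0) :
    extendZero (fun i : Fin n => b i) = b := by
  funext i
  rcases lt_or_ge i n with hi | hi
  · rw [extendZero_of_lt _ hi]
  · rw [extendZero_of_le _ hi, h i hi]

theorem mem_IS102_iff {n : ℕ} (e : Fin n → ℕ) : e ∈ IS102 n ↔ extendZero e ∈ AvoidingSeq n := by
  constructor
  · rintro ⟨h1, h2⟩
    rw [avoidsPattern_102_iff] at h2
    refine ⟨fun i => ?_, fun i => extendZero_of_le e, fun i j k hij hjk hlt => ?_⟩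
    · rcases lt_or_ge i n with hi | hi
      · rw [extendZero_of_lt _ hi]; exact h1 _
      · rw [extendZero_of_le _ hi]; exact Nat.zero_le _
    · rcases lt_or_ge k n with hk | hk
      · rw [extendZero_of_lt e (by omega : i < n), extendZero_of_lt e (by omega : j < n)] at hlt
        rw [extendZero_of_lt e (by omega : i < n), extendZero_of_lt e hk]
        exact h2 _ _ _ hij hjk hlt
      · rw [extendZero_of_le _ hk]; exact Nat.zero_le _
  · rintro ⟨h1, -, h3⟩
    refine ⟨fun i => ?_, (avoidsPattern_102_iff e).2 fun a b c hab hbc hlt => ?_⟩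
    · rw [← extendZero_val e]; exact h1 i
    · rw [← extendZero_val e, ← extendZero_val e] at hlt ⊢
      exact h3 _ _ _ hab hbc hlt

theorem seqEntry_succ {n : ℕ} (e : Fin n → ℕ) {i : ℕ} (h : i < n) :
    seqEntry e (i + 1) = extendZero e i := by
  rw [seqEntry, dif_pos (by omega), extendZero_of_lt _ h]
  rfl

theorem seqEntry_of_lt {n : ℕ} (e : Fin n → ℕ) {i : ℕ} (h : n < i) : seqEntry e i = -1 :=
  dif_neg (by omega)

theorem extendZero_le_seqMax {n : ℕ} (e : Fin n → ℕ) (i : ℕ) : extendZero e i ≤ seqMax e := by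
  rcases lt_or_ge i n with hi | hi
  · rw [extendZero_of_lt _ hi]
    exact Finset.le_sup (f := e) (Finset.mem_univ _)
  · rw [extendZero_of_le _ hi]; exact Nat.zero_le _

theorem exists_extendZero_eq_seqMax {n : ℕ} (hn : 1 ≤ n) (e : Fin n → ℕ) :
    ∃ i, extendZero e i = seqMax e := by
  obtain ⟨i, -, hi⟩ := Finset.exists_mem_eq_sup Finset.univ ⟨⟨0, hn⟩, Finset.mem_univ _⟩ e
  exact ⟨i, by rw [extendZero_val]; exact hi.symm⟩

theorem isLeast_firstDescent {n : ℕ} (hn : 1 ≤ n) (e : Fin n → ℕ) :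
    IsLeast {p : ℕ | 1 ≤ p ∧ seqEntry e p > seqEntry e (p + 1)} (firstDescent e) := by
  have hne : {p : ℕ | 1 ≤ p ∧ seqEntry e p > seqEntry e (p + 1)}.Nonempty := by
    refine ⟨n, hn, ?_⟩
    obtain ⟨m, rfl⟩ := Nat.exists_eq_add_of_le' hn
    rw [seqEntry_of_lt e (by omega : m + 1 < m + 1 + 1), seqEntry_succ e (by omega)]
    omega
  exact ⟨Nat.sInf_mem hne, fun p hp => Nat.sInf_le hp⟩

/-- The first descent of `e` is at the one-based position `p + 1`. -/
theorem firstDescent_eq_iff {n : ℕ} (e : Fin n → ℕ) (p : ℕ) (hn : 1 ≤ n) :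
    firstDescent e = p + 1 ↔ p < n ∧ (∀ i j, i ≤ j → j ≤ p → extendZero e i ≤ extendZero e j) ∧
      (p + 1 < n → extendZero e (p + 1) < extendZero e p) := by
  have hL := isLeast_firstDescent hn e
  constructor
  · intro h
    rw [h] at hL
    obtain ⟨⟨-, h1⟩, h2⟩ := hL
    -- Beyond the end, both entries compared would be the default `-1`.
    have hp : p < n := by
      by_contra! hc
      rw [seqEntry_of_lt e (by omega : n < p + 1), seqEntry_of_lt e (by omega : n < p + 1 + 1)] at h1
      omega
    refine ⟨hp, fun i j hij hj => ?_, fun hlt => ?_⟩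
    · induction j, hij using Nat.le_induction with
      | base => exact le_rfl
      | succ j hij ih =>
        refine (ih (by omega)).trans ?_
        by_contra! hc
        have := h2 (show j + 1 ∈ _ from ⟨by omega, by
          rw [seqEntry_succ e (by omega : j + 1 < n), seqEntry_succ e (by omega : j < n)]
          exact_mod_cast hc⟩)
        omega
    · rw [seqEntry_succ e hlt, seqEntry_succ e hp] at h1
      exact_mod_cast h1
  · rintro ⟨hp, h1, h2⟩
    refine hL.unique ⟨⟨by omega, ?_⟩, ?_⟩
    · rw [seqEntry_succ e hp]
      rcases lt_or_ge (p + 1) n with h | h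
      · rw [seqEntry_succ e h]
        exact_mod_cast h2 h
      · rw [seqEntry_of_lt e (by omega)]
        omega
    · rintro q ⟨hq, hq'⟩
      by_contra! hc
      obtain ⟨q, rfl⟩ := Nat.exists_eq_add_of_le' hq
      rw [seqEntry_succ e (by omega : q + 1 < n), seqEntry_succ e (by omega : q < n)] at hq'
      have := h1 q (q + 1) (by omega) (by omega)
      omega

/-- The padding here is `0` rather than `-1`, so the descent at the end of the sequence is encoded
by the bound `M + s ≤ n` in `RankGe`. -/
theorem mem_IS102Rank_iff {n : ℕ} (t : ℕ) (hn : 1 ≤ n) (e : Fin n → ℕ) :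
    e ∈ IS102Rank n t ↔ extendZero e ∈ RankEq n (t + 1) := by
  have hmax := extendZero_le_seqMax e
  obtain ⟨k, hk⟩ := exists_extendZero_eq_seqMax hn e
  have hrank : seqRank e = (t : ℤ) ↔ firstDescent e = seqMax e + t + 1 := by
    unfold seqRank
    omega
  have hA := mem_IS102_iff e
  constructor
  · rintro ⟨he, hr⟩
    obtain ⟨h1, h2, h3⟩ := (firstDescent_eq_iff e _ hn).1 (hrank.1 hr)
    refine ⟨⟨hA.1 he, _, hmax, ⟨k, hk⟩, h1, fun i j hij hj => h2 i j hij (by omega)⟩, ?_⟩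
    rintro ⟨-, M, hM, ⟨l, hl⟩, h4, h5⟩
    have : M = seqMax e := by rw [← topValue_eq hM hl, topValue_eq hmax hk]
    subst this
    have := h3 (by omega)
    have := h5 (seqMax e + t) (seqMax e + t + 1) (by omega) (by omega)
    omega
  · rintro ⟨⟨he, M, hM, ⟨l, hl⟩, h4, h5⟩, hn'⟩
    have : M = seqMax e := by rw [← topValue_eq hM hl, topValue_eq hmax hk]
    subst this
    refine ⟨hA.2 he, hrank.2 ((firstDescent_eq_iff e _ hn).2
      ⟨h4, fun i j hij hj => h5 i j hij (by omega), fun hlt => ?_⟩)⟩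
    by_contra! hc
    refine hn' ⟨he, _, hmax, ⟨k, hk⟩, by omega, fun i j hij hj => ?_⟩
    rcases eq_or_ne j (seqMax e + t + 1) with rfl | hne
    · rcases eq_or_ne i (seqMax e + t + 1) with rfl | hne'
      · exact le_rfl
      · exact (h5 i (seqMax e + t) (by omega) (by omega)).trans hc
    · exact h5 i j hij (by omega)

theorem ncard_IS102Rank {n : ℕ} (t : ℕ) (hn : 1 ≤ n) :
    (IS102Rank n t).ncard = (RankEq n (t + 1)).ncard := by
  refine Set.ncard_eq_of_inverse extendZero (fun b i => b i)
    (fun e he => ⟨(mem_IS102Rank_iff t hn e).1 he, funext (extendZero_val e)⟩) fun b hb => ?_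
  have h := extendZero_restrict (n := n) hb.1.1.2.1
  exact ⟨(mem_IS102Rank_iff t hn _).2 (h.symm ▸ hb), h⟩

theorem finite_IS102Rank (n t : ℕ) : (IS102Rank n t).Finite := by
  have h : (Set.pi Set.univ fun i : Fin n => Set.Iic (i : ℕ)).Finite :=
    Set.Finite.pi fun i => Set.finite_Iic _
  exact h.subset fun e he i _ => he.1.1 i

/-! ### Initial segments of UVD paths -/

theorem pathEnd_concat (S : List UVDStep) (a : UVDStep) :
    pathEnd (S ++ [a]) = pathEnd S + a.vec := by
  simp [pathEnd]

/-- The difference of the coordinates grows by `2` at each `d` or `v` and is unchanged by `u`. Hence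
a word with `m = 0` cannot end with `d` or `v`. -/
theorem pathEnd_snd_le_fst (S : List UVDStep) : (pathEnd S).2 ≤ (pathEnd S).1 := by
  induction S using List.reverseRecOn with
  | nil => simp [pathEnd]
  | append_singleton S a ih =>
    rw [pathEnd_concat]
    cases a <;> simp [UVDStep.vec] <;> omega

theorem pair_suffix_concat_iff {α : Type*} (S : List α) (x y a : α) :
    [x, y] <:+ S ++ [a] ↔ y = a ∧ S.getLast? = some x := by
  rw [show [x, y] = [x] ++ [y] from rfl, List.suffix_concat_iff]
  constructor
  · rintro (h | ⟨t, h, h'⟩)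
    · simp at h
    · obtain ⟨h1, h2⟩ := List.append_inj' h rfl
      subst h1
      refine ⟨by simpa using h2, ?_⟩
      obtain ⟨r, rfl⟩ := h'
      simp
  · rintro ⟨rfl, h⟩
    refine Or.inr ⟨[x], rfl, ?_⟩
    rw [List.getLast?_eq_some_iff] at h
    obtain ⟨r, rfl⟩ := h
    exact List.suffix_append _ _

theorem pair_infix_concat_iff {α : Type*} (S : List α) (x y a : α) :
    [x, y] <:+: S ++ [a] ↔ (y = a ∧ S.getLast? = some x) ∨ [x, y] <:+: S := by
  rw [List.infix_concat_iff, pair_suffix_concat_iff]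

/-- A new letter can only create a valley at the vertex where it is attached. -/
theorem axisValleys_concat (S : List UVDStep) (a : UVDStep) :
    axisValleys (S ++ [a]) = axisValleys S +
      if S.getLast? = some .d ∧ a = .u ∧ (pathEnd S).2 = 0 then 1 else 0 := by
  rcases List.eq_nil_or_concat' S with rfl | ⟨r, x, rfl⟩
  · simp [axisValleys]
  · have hlen : (r ++ [x] ++ [a]).length = r.length + 1 + 1 := by simp
    have hlen' : (r ++ [x]).length = r.length + 1 := by simp
    rw [axisValleys, axisValleys, Finset.card_filter, Finset.card_filter, hlen, hlen',
      Finset.sum_range_succ, Finset.sum_range_succ, Finset.sum_range_succ]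
    have hsum : ∀ i ∈ Finset.range r.length,
        (if (r ++ [x] ++ [a])[i]? = some UVDStep.d ∧ (r ++ [x] ++ [a])[i + 1]? = some UVDStep.u ∧
          (pathEnd ((r ++ [x] ++ [a]).take (i + 1))).2 = 0 then 1 else 0) =
        if (r ++ [x])[i]? = some UVDStep.d ∧ (r ++ [x])[i + 1]? = some UVDStep.u ∧
          (pathEnd ((r ++ [x]).take (i + 1))).2 = 0 then 1 else 0 := by
      intro i hi
      have hi := Finset.mem_range.1 hi
      rw [List.getElem?_append_left (by omega : i < (r ++ [x]).length),
        List.getElem?_append_left (by omega : i + 1 < (r ++ [x]).length),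
        List.take_append_of_le_length (by omega : i + 1 ≤ (r ++ [x]).length)]
    rw [Finset.sum_congr rfl hsum]
    have h1 : (r ++ [x] ++ [a])[r.length + 1 + 1]? = none := List.getElem?_eq_none (by omega)
    have h2 : (r ++ [x])[r.length + 1]? = none := List.getElem?_eq_none (by omega)
    have h3 : (r ++ [x] ++ [a])[r.length]? = some x := by simp
    have h4 : (r ++ [x] ++ [a])[r.length + 1]? = some a := by simp
    have h5 : (r ++ [x] ++ [a]).take (r.length + 1) = r ++ [x] := by
      rw [← hlen', List.take_left]
    rw [h1, h2, h3, h4, h5]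
    simp

/-- The conditions on UVD paths that do not involve the end of the path. -/
def IsUVDPrefix (S : List UVDStep) : Prop :=
  (∀ P : List UVDStep, P <+: S → 0 ≤ (pathEnd P).2) ∧
    ¬ [UVDStep.u, UVDStep.v] <:+: S ∧ ¬ [UVDStep.v, UVDStep.u] <:+: S

theorem isUVDPrefix_nil : IsUVDPrefix [] := by
  refine ⟨fun P hP => ?_, by simp, by simp⟩
  rw [List.prefix_nil.1 hP]
  exact le_rfl

theorem isUVDPrefix_concat_iff (S : List UVDStep) (a : UVDStep) :
    IsUVDPrefix (S ++ [a]) ↔ IsUVDPrefix S ∧ 0 ≤ (pathEnd S).2 + a.vec.2 ∧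
      ¬ (UVDStep.v = a ∧ S.getLast? = some .u) ∧ ¬ (UVDStep.u = a ∧ S.getLast? = some .v) := by
  simp only [IsUVDPrefix, pair_infix_concat_iff, not_or]
  constructor
  · rintro ⟨h1, ⟨h2, h3⟩, h4, h5⟩
    refine ⟨⟨fun P hP => h1 P (hP.trans (List.prefix_append _ _)), h3, h5⟩, ?_, h2, h4⟩
    have := h1 _ List.prefix_rfl
    rwa [pathEnd_concat] at this
  · rintro ⟨⟨h1, h3, h5⟩, h, h2, h4⟩
    refine ⟨fun P hP => ?_, ⟨h2, h3⟩, h4, h5⟩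
    rcases List.prefix_concat_iff.1 hP with rfl | hP
    · rwa [pathEnd_concat]
    · exact h1 P hP

/-- The words with `m` steps `d` or `v`, final height `h`, `t` valleys on the axis and last letter `l`
that satisfy `IsUVDPrefix`. -/
def UVDWords (m h t : ℕ) (l : UVDStep) : Set (List UVDStep) :=
  {S | IsUVDPrefix S ∧ pathEnd S = (2 * (m : ℤ) + h, (h : ℤ)) ∧ axisValleys S = t ∧
    S.getLast? = some l}

theorem concat_mem_UVDWords_iff {m h t : ℕ} {S : List UVDStep} {a : UVDStep} :
    S ++ [a] ∈ UVDWords m h t a ↔ IsUVDPrefix S ∧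
      ¬ (UVDStep.v = a ∧ S.getLast? = some .u) ∧ ¬ (UVDStep.u = a ∧ S.getLast? = some .v) ∧
      (pathEnd S).1 + a.vec.1 = 2 * (m : ℤ) + h ∧ (pathEnd S).2 + a.vec.2 = (h : ℤ) ∧
      (axisValleys S + if S.getLast? = some .d ∧ a = .u ∧ (pathEnd S).2 = 0 then 1 else 0) = t := by
  simp only [UVDWords, Set.mem_ofPred_eq, isUVDPrefix_concat_iff, pathEnd_concat,
    axisValleys_concat, List.getLast?_concat, and_true, Prod.ext_iff, Prod.fst_add, Prod.snd_add]
  constructor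
  · rintro ⟨⟨h1, h2, h3, h4⟩, ⟨h5, h6⟩, h7⟩
    exact ⟨h1, h3, h4, h5, h6, h7⟩
  · rintro ⟨h1, h3, h4, h5, h6, h7⟩
    exact ⟨⟨h1, by rw [h6]; exact Int.natCast_nonneg h, h3, h4⟩, ⟨h5, h6⟩, h7⟩

theorem UVDWords_eq_image {m h t : ℕ} {a : UVDStep} {W : Set (List UVDStep)}
    (hW : ∀ S, S ++ [a] ∈ UVDWords m h t a ↔ S ∈ W) : UVDWords m h t a = (· ++ [a]) '' W := by
  ext S
  constructor
  · intro hS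
    obtain ⟨S, rfl⟩ := List.getLast?_eq_some_iff.1 hS.2.2.2
    exact ⟨S, (hW S).1 hS, rfl⟩
  · rintro ⟨S, hS, rfl⟩
    exact (hW S).2 hS

theorem UVDWords_eq_empty {m h t : ℕ} {a : UVDStep}
    (hW : ∀ S, S ++ [a] ∉ UVDWords m h t a) : UVDWords m h t a = ∅ := by
  rw [UVDWords_eq_image (W := ∅) fun S => ⟨fun h => (hW S h).elim, fun h => h.elim⟩, Set.image_empty]

theorem UVDWords_zero_d (h t : ℕ) : UVDWords 0 h t .d = ∅ := by
  refine UVDWords_eq_empty fun S hS => ?_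
  rw [concat_mem_UVDWords_iff] at hS
  obtain ⟨-, -, -, h1, h2, -⟩ := hS
  have := pathEnd_snd_le_fst S
  simp only [UVDStep.vec] at h1 h2
  omega

theorem UVDWords_zero_v (h t : ℕ) : UVDWords 0 h t .v = ∅ := by
  refine UVDWords_eq_empty fun S hS => ?_
  rw [concat_mem_UVDWords_iff] at hS
  obtain ⟨-, -, -, h1, h2, -⟩ := hS
  have := pathEnd_snd_le_fst S
  simp only [UVDStep.vec] at h1 h2
  omega

theorem UVDWords_succ_d (m h t : ℕ) :
    UVDWords (m + 1) h t .d = (· ++ [.d]) '' (UVDWords m (h + 1) t .u ∪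
      (UVDWords m (h + 1) t .d ∪ UVDWords m (h + 1) t .v)) := by
  refine UVDWords_eq_image fun S => ?_
  rw [concat_mem_UVDWords_iff]
  simp only [UVDWords, Set.mem_union, Set.mem_ofPred_eq, UVDStep.vec, Prod.ext_iff]
  rcases hl : S.getLast? with _ | l
  · rw [List.getLast?_eq_none_iff] at hl
    subst hl
    simp [pathEnd]
  · cases l <;> simp <;> intro _ <;> constructor <;> rintro ⟨h1, h2, h3⟩ <;>
      refine ⟨?_, ?_⟩ <;> first | assumption | omega

theorem UVDWords_succ_v (m h t : ℕ) :
    UVDWords (m + 1) h t .v = (· ++ [.v]) '' (UVDWords m (h + 2) t .d ∪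
      UVDWords m (h + 2) t .v) := by
  refine UVDWords_eq_image fun S => ?_
  rw [concat_mem_UVDWords_iff]
  simp only [UVDWords, Set.mem_union, Set.mem_ofPred_eq, UVDStep.vec, Prod.ext_iff]
  rcases hl : S.getLast? with _ | l
  · rw [List.getLast?_eq_none_iff] at hl
    subst hl
    simp [pathEnd]
  · cases l <;> simp <;> intro _ <;> constructor <;> rintro ⟨h1, h2, h3⟩ <;>
      refine ⟨?_, ?_⟩ <;> first | assumption | omega

/-- The last `u` starts at positive height, so it creates no axis valley; the letter before it
cannot be `v`. -/
theorem UVDWords_add_two_u (m h t : ℕ) :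
    UVDWords m (h + 2) t .u = (· ++ [.u]) '' (UVDWords m (h + 1) t .u ∪
      UVDWords m (h + 1) t .d) := by
  refine UVDWords_eq_image fun S => ?_
  rw [concat_mem_UVDWords_iff]
  simp only [UVDWords, Set.mem_union, Set.mem_ofPred_eq, UVDStep.vec, Prod.ext_iff]
  rcases hl : S.getLast? with _ | l
  · rw [List.getLast?_eq_none_iff] at hl
    subst hl
    simp [pathEnd]
    omega
  · cases l <;> simp <;> intro _
    · constructor <;> rintro ⟨h1, h2, h3⟩ <;> refine ⟨?_, ?_⟩ <;> first | assumption | omega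
    · constructor
      · rintro ⟨h1, h2, h3⟩
        rw [if_neg (by omega)] at h3
        exact ⟨by omega, h3⟩
      · rintro ⟨⟨h1, h2⟩, h3⟩
        rw [if_neg (by omega)]
        exact ⟨by omega, by omega, h3⟩

theorem pathEnd_snd_pos {S : List UVDStep} (hS : IsUVDPrefix S) (hl : S.getLast? = some .u) :
    0 < (pathEnd S).2 := by
  obtain ⟨S, rfl⟩ := List.getLast?_eq_some_iff.1 hl
  have := hS.1 S (List.prefix_append _ _)
  rw [pathEnd_concat]
  simp only [UVDStep.vec, Prod.snd_add]
  omega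

/-- A final `u` reaching height `1` starts on the axis. The letter before it must be `d`, which
makes a new valley, unless the word is just `u`, which has no valley. -/
theorem UVDWords_one_u_succ (m t : ℕ) :
    UVDWords m 1 (t + 1) .u = (· ++ [.u]) '' UVDWords m 0 t .d := by
  refine UVDWords_eq_image fun S => ?_
  rw [concat_mem_UVDWords_iff]
  simp only [UVDWords, Set.mem_ofPred_eq, UVDStep.vec, Prod.ext_iff]
  rcases hl : S.getLast? with _ | l
  · rw [List.getLast?_eq_none_iff] at hl
    subst hl
    simp [pathEnd, axisValleys]
  · cases l <;> simp <;> intro hS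
    · have := pathEnd_snd_pos hS hl
      omega
    · constructor
      · rintro ⟨h1, h2, h3⟩
        rw [if_pos h2] at h3
        exact ⟨⟨h1, h2⟩, by omega⟩
      · rintro ⟨⟨h1, h2⟩, h3⟩
        rw [if_pos h2]
        exact ⟨h1, h2, by omega⟩

theorem UVDWords_one_u_zero (m : ℕ) :
    UVDWords m 1 0 .u = (· ++ [.u]) '' (if m = 0 then {[]} else ∅) := by
  refine UVDWords_eq_image fun S => ?_
  rw [concat_mem_UVDWords_iff]
  rcases hl : S.getLast? with _ | l
  · rw [List.getLast?_eq_none_iff] at hl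
    subst hl
    rcases m with _ | m
    · simp [pathEnd, axisValleys, UVDStep.vec, isUVDPrefix_nil]
    · simp [pathEnd, axisValleys, UVDStep.vec, isUVDPrefix_nil]
      omega
  · have hne : S ∉ (if m = 0 then {[]} else ∅ : Set (List UVDStep)) := by
      split_ifs
      · rintro rfl
        simp at hl
      · exact fun h => h
    refine iff_of_false ?_ hne
    rintro ⟨h1, -, h2, h3, h4, h5⟩
    simp only [UVDStep.vec] at h3 h4
    cases l
    · have := pathEnd_snd_pos h1 hl
      omega
    · simp at h2
    · rw [if_pos ⟨rfl, rfl, by omega⟩] at h5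
      omega

/-! ### Counting UVD paths -/

/-- `s` is finite with `q` elements. -/
def HasCount {α : Type*} (s : Set α) (q : ℚ) : Prop :=
  s.Finite ∧ (s.ncard : ℚ) = q

theorem hasCount_empty {α : Type*} : HasCount (∅ : Set α) 0 := by
  simp [HasCount]

theorem HasCount.union {α : Type*} {s t : Set α} {p q : ℚ} (hs : HasCount s p) (ht : HasCount t q)
    (h : Disjoint s t) : HasCount (s ∪ t) (p + q) := by
  refine ⟨hs.1.union ht.1, ?_⟩
  rw [Set.ncard_union_eq h hs.1 ht.1, Nat.cast_add, hs.2, ht.2]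

theorem HasCount.image_concat {W : Set (List UVDStep)} {q : ℚ} (hW : HasCount W q) (a : UVDStep) :
    HasCount ((· ++ [a]) '' W) q :=
  ⟨hW.1.image _, by rw [Set.ncard_image_of_injective _ (List.append_left_injective [a]), hW.2]⟩

theorem disjoint_UVDWords {m h t : ℕ} {a b : UVDStep} (hab : a ≠ b) :
    Disjoint (UVDWords m h t a) (UVDWords m h t b) := by
  rw [Set.disjoint_left]
  rintro S ⟨-, -, -, h1⟩ ⟨-, -, -, h2⟩
  rw [h1] at h2
  exact hab (Option.some.inj h2)

open PowerSeries in
/-- The generating functions, in the number `m` of steps `d` or `v`, of the words that end with `u`,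
with `d` on the axis, with `d` above the axis, and with `v`. -/
theorem hasCount_UVDWords {P T Q : PowerSeries ℚ} (hPQ : P = X * Q) (hT : T = 1 + X * (T * Q))
    (hQ : T + X * (T ^ 2 * (Q - 1)) = Q) (m : ℕ) :
    (∀ h t, HasCount (UVDWords m (h + 1) t .u) (coeff m (P ^ t * T ^ h))) ∧
    (∀ t, HasCount (UVDWords m 0 t .d) (coeff m (P ^ (t + 1)))) ∧
    (∀ h t, HasCount (UVDWords m (h + 1) t .d) (coeff m (P ^ t * T ^ h * (T - 1)))) ∧
    (∀ h t, HasCount (UVDWords m h t .v) (coeff m (X * (P ^ t * T ^ (h + 1) * (Q - 1))))) := by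
  have hPt : ∀ t, P ^ (t + 1) = X * (P ^ t * Q) := fun t => by
    rw [pow_succ]; nth_rw 2 [hPQ]; ring
  have hPT : ∀ h t, P ^ t * T ^ h * (T - 1) = X * (P ^ t * T ^ (h + 1) * Q) := fun h t => by
    have : T - 1 = X * (T * Q) := by linear_combination hT
    rw [this]; ring
  -- A `u` step leaves `m` unchanged, so the words ending with `u` follow, by induction on the
  -- height, from those ending with `d` for the same `m`.
  have hu : ∀ m, (∀ t, HasCount (UVDWords m 0 t .d) (coeff m (P ^ (t + 1)))) →
      (∀ h t, HasCount (UVDWords m (h + 1) t .d) (coeff m (P ^ t * T ^ h * (T - 1)))) →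
      ∀ h t, HasCount (UVDWords m (h + 1) t .u) (coeff m (P ^ t * T ^ h)) := by
    intro m h0 h1 h
    induction h with
    | zero =>
      intro t
      rcases t with _ | t
      · rw [zero_add, UVDWords_one_u_zero]
        refine HasCount.image_concat ?_ _
        rw [pow_zero, pow_zero, mul_one, coeff_one]
        split_ifs
        · simp [HasCount]
        · exact hasCount_empty
      · rw [zero_add, UVDWords_one_u_succ, pow_zero, mul_one]
        exact (h0 t).image_concat _
    | succ h ih =>
      intro t
      rw [add_assoc, UVDWords_add_two_u,
        show P ^ t * T ^ (h + 1) = P ^ t * T ^ h + P ^ t * T ^ h * (T - 1) by ring, map_add]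
      exact ((ih t).union (h1 h t) (disjoint_UVDWords (by decide))).image_concat _
  suffices hm : (∀ t, HasCount (UVDWords m 0 t .d) (coeff m (P ^ (t + 1)))) ∧
      (∀ h t, HasCount (UVDWords m (h + 1) t .d) (coeff m (P ^ t * T ^ h * (T - 1)))) ∧
      (∀ h t, HasCount (UVDWords m h t .v) (coeff m (X * (P ^ t * T ^ (h + 1) * (Q - 1))))) from
    ⟨hu m hm.1 hm.2.1, hm⟩
  induction m with
  | zero =>
    refine ⟨fun t => ?_, fun h t => ?_, fun h t => ?_⟩
    · rw [UVDWords_zero_d, hPt, coeff_zero_X_mul]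
      exact hasCount_empty
    · rw [UVDWords_zero_d, hPT, coeff_zero_X_mul]
      exact hasCount_empty
    · rw [UVDWords_zero_v, coeff_zero_X_mul]
      exact hasCount_empty
  | succ m ih =>
    obtain ⟨ih0, ihd, ihv⟩ := ih
    have ihu := hu m ih0 ihd
    -- The three possible letters before `d` contribute `P ^ t * T ^ h` times `1`, `T - 1` and `X *
    -- T ^ 2 * (Q - 1)`; by `hQ` these factors add up to `Q`.
    have hd : ∀ h t, HasCount (UVDWords (m + 1) h t .d) (coeff m (P ^ t * T ^ h * Q)) := by
      intro h t
      have e : P ^ t * T ^ h * Q = P ^ t * T ^ h + (P ^ t * T ^ h * (T - 1) +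
          X * (P ^ t * T ^ (h + 1 + 1) * (Q - 1))) := by
        linear_combination -(P ^ t * T ^ h) * hQ
      rw [UVDWords_succ_d, e, map_add, map_add]
      refine ((ihu h t).union ((ihd h t).union (ihv (h + 1) t) (disjoint_UVDWords (by decide)))
        ?_).image_concat _
      rw [Set.disjoint_union_right]
      exact ⟨disjoint_UVDWords (by decide), disjoint_UVDWords (by decide)⟩
    refine ⟨fun t => ?_, fun h t => ?_, fun h t => ?_⟩
    · have := hd 0 t
      rwa [pow_zero, mul_one, ← coeff_succ_X_mul, ← hPt] at this
    · rw [hPT, coeff_succ_X_mul]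
      exact hd (h + 1) t
    -- Before `v` the letter `u` is forbidden, so the summand `1` is missing and the sum is `Q - 1`.
    · have e : P ^ t * T ^ (h + 1) * (Q - 1) = P ^ t * T ^ (h + 1) * (T - 1) +
          X * (P ^ t * T ^ (h + 2 + 1) * (Q - 1)) := by
        linear_combination -(P ^ t * T ^ (h + 1)) * hQ
      rw [coeff_succ_X_mul, UVDWords_succ_v, e, map_add]
      exact ((ihd (h + 1) t).union (ihv (h + 2) t) (disjoint_UVDWords (by decide))).image_concat _

theorem UVDPathsValleys_eq (n t : ℕ) : UVDPathsValleys n t = UVDWords n 0 t .d := by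
  ext S
  constructor
  · rintro ⟨⟨h1, h2, h3, h4, h5⟩, h6⟩
    obtain ⟨r, rfl⟩ := h5
    exact ⟨⟨h2, h3, h4⟩, by rw [h1]; simp, h6, by simp⟩
  · rintro ⟨⟨h2, h3, h4⟩, h1, h6, h5⟩
    obtain ⟨r, rfl⟩ := List.getLast?_eq_some_iff.1 h5
    exact ⟨⟨by rw [h1]; simp, h2, h3, h4, ⟨r, rfl⟩⟩, h6⟩

open PowerSeries in
-- With `P = X * Q` and `T = 1 / (1 - P)`, the equation for `P` becomes `Q = (1 - X) * T ^ 2` after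
-- cancelling `X`; this and `T - 1 = X * T * Q` yield the two relations needed for the word counts.
theorem hasCount_UVDPathsValleys {P : PowerSeries ℚ} (h0 : constantCoeff P = 0)
    (hP : P * (1 - P) ^ 2 = X - X ^ 2) (n t : ℕ) :
    HasCount (UVDPathsValleys n t) (coeff n (P ^ (t + 1))) := by
  obtain ⟨Q, rfl⟩ := X_dvd_iff.2 h0
  have hunit : (1 - X * Q) * (1 - X * Q)⁻¹ = 1 := PowerSeries.mul_inv_cancel _ (by simp)
  set T := (1 - X * Q)⁻¹
  have hT : T = 1 + X * (T * Q) := by linear_combination hunit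
  have hQ : Q * (1 - X * Q) ^ 2 = 1 - X := by
    refine mul_left_cancel₀ (X_ne_zero (R := ℚ)) ?_
    linear_combination hP
  have hQT : Q = (1 - X) * T ^ 2 := by
    calc Q = Q * ((1 - X * Q) * T) ^ 2 := by rw [hunit]; ring
      _ = Q * (1 - X * Q) ^ 2 * T ^ 2 := by ring
      _ = _ := by rw [hQ]
  rw [UVDPathsValleys_eq]
  refine (hasCount_UVDWords rfl hT ?_ n).2.1 t
  linear_combination -hQT - T * hT

/-! ### Conclusion: rank `t` and `t` axis valleys both correspond to column `t + 1` -/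

theorem mainTheorem3 (n t : ℕ) (hn : 1 ≤ n) (ht : t ≤ n - 1) :
    (IS102Rank n t).Finite ∧ (UVDPathsValleys n t).Finite ∧
    (IS102Rank n t).ncard = (UVDPathsValleys n t).ncard ∧
    ((UVDPathsValleys n t).ncard : ℚ) =
      ∑ j ∈ Finset.Icc (t + 1) n,
        (-1 : ℚ) ^ (n - j) * (((t : ℚ) + 1) / (j : ℚ)) *
          ((3 * j - t - 2).choose (j - t - 1) : ℚ) * (j.choose (n - j) : ℚ) := by
  obtain ⟨P, h0, hP⟩ := exists_rankSeries
  have hφ := isRankArray_coeff_pow h0 hP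
  obtain ⟨hfin, hcard⟩ := hasCount_UVDPathsValleys h0 hP n t
  refine ⟨finite_IS102Rank n t, hfin, ?_, ?_⟩
  · rw [ncard_IS102Rank t hn, ← Nat.cast_inj (R := ℚ), hcard]
    exact congrFun (congrFun (isRankArray_ncard_rankEq.unique hφ) n) (t + 1)
  · rw [hcard, ← closedForm_eq_sum]
    exact congrFun (congrFun (hφ.unique isRankArray_closedForm) n) (t + 1)
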